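/- A permutation is a permutation of a finite set of positive integers, written in one-line notation, and $S_n$ is the set of permutations of $\{1,\dots,n\}$. West's stack-sorting map $s$ sends a permutation $\pi=\pi_1\cdots\pi_n$ through a stack: at each step, if input remains and the next input entry is smaller than the entry at the top of the stack or the stack is empty, that input entry is pushed onto the stack; otherwise the top of the stack is popped and appended to the output. The process stops when the output has length $n$, and $s(\pi)$ is this output. A permutation is $t$-sorted if it equals $s^t(\mu)$ for some permutation $\mu$, where $s^t$ is the $t$-fold iterate of $s$. A descent of $\pi$ is an index $i\in\{1,\dots,n-1\}$ with $\pi_i>\pi_{i+1}$, and a left-to-right maximum of $\pi$ is an entry that is larger than every entry to its left. **Theorem.** Let $n\ge t\ge 2$ with $n\equiv t\pmod 2$. A permutation $\pi=\pi_1\cdots\pi_n\in S_n$ is $t$-sorted and has exactly $\frac{n-t}{2}$ descents if and only if its left-to-right maxima are exactly $$\pi_1,\pi_3,\pi_5,\ldots,\pi_{n-t+1},\pi_{n-t+2},\pi_{n-t+3},\ldots,\pi_n.$$ In particular, the number of such permutations is $(n-t-1)!!$, where $(-1)!!=1$. -/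

import Mathlib

open scoped Nat

namespace StackSort

/-- Permutations of finite sets of positive integers, in one-line notation. -/
def IsPermutation (p : List ℕ) : Prop := p.Nodup ∧ ∀ x ∈ p, 0 < x

/-- `Sn n` is the set of permutations of `{1, …, n}`, in one-line notation. -/
def Sn (n : ℕ) : Set (List ℕ) := {p | p.Nodup ∧ p.toFinset = Finset.Icc 1 n}

/-- The run of the stack on the remaining input (first argument) with the current stack
(second argument, top first). The value is the list of the entries that are still to be output,
in the order in which they are output. The next input entry is pushed if the stack is empty or
if that entry is smaller than the top of the stack; otherwise (also when the input is
exhausted) the top of the stack is popped to the output. -/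
def run : List ℕ → List ℕ → List ℕ
  | [], [] => []
  | [], b :: st => b :: run [] st
  | a :: rest, [] => run rest [a]
  | a :: rest, b :: st => if a < b then run rest (a :: b :: st) else b :: run (a :: rest) st
termination_by input st => 2 * input.length + st.length

/-- West's stack-sorting map. -/
def stackSort (p : List ℕ) : List ℕ := run p []

/-- A permutation is `t`-sorted if it is `s^t(μ)` for some permutation `μ`. -/
def IsTSorted (t : ℕ) (p : List ℕ) : Prop := ∃ μ, IsPermutation μ ∧ stackSort^[t] μ = p

/-- The entry `p_i` in position `i`, for positions `1 ≤ i ≤ p.length`. -/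
def entry (p : List ℕ) (i : ℕ) : ℕ := p.getD (i - 1) 0

/-- The descents: the indices `1 ≤ i ≤ p.length - 1` with `p_i > p_{i+1}`. -/
def descents (p : List ℕ) : Finset ℕ :=
  {i ∈ Finset.Ico 1 p.length | entry p i > entry p (i + 1)}

/-- The number of descents. -/
def des (p : List ℕ) : ℕ := (descents p).card

/-- The set of left-to-right maxima: the entries larger than everything to their left. -/
def leftToRightMaxima (p : List ℕ) : Finset ℕ :=
  Finset.image (entry p)
    {i ∈ Finset.Icc 1 p.length | ∀ j < i, 1 ≤ j → entry p j < entry p i}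

/-- The positions `1, 3, 5, …, n - t + 1, n - t + 2, n - t + 3, …, n` (for `t ≤ n` with
`n - t` even). -/
def extremalPositions (n t : ℕ) : Finset ℕ :=
  {i ∈ Finset.Icc 1 n | (Odd i ∧ i ≤ n - t + 1) ∨ n - t + 2 ≤ i}

end StackSort

/-!
If `m` is the largest entry of `L m R`, then `s(L m R) = s(L) s(R) m` (`stackSort_append_cons`).
Hence a sorted permutation of length `n ≥ 1` has at most `(n - 1) / 2` descents, with equality
only if both `L` and `R` are nonempty (or `n = 1`), both images are extremal and there is a descent
between them. Since `s` fixes a largest entry standing at the end, every further application of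
`s` only adds a largest entry at the end, so the case of `t`-sorted permutations reduces to
the extremal images `s(w)` with `w = s(L) s(R)`. Here equality in the bound forces
`s(w) = s(w') r m` with `w'` of the same form and extremal, `r < max w'` and `m` the maximum, so
that the left-to-right maxima stand at every other position (`lrMaxAt_even_of_numDescents_eq`).

Conversely, a permutation with the given left-to-right maxima is `M₁ r₁ M₂ r₂ ⋯ M_c r_c M_{c+1} ⋯`
with `M` increasing and `r_k < M_k`. Moving all the `r_k` one step to the right, past the next
`M`, gives a preimage under `s` (`stackSort_append_weave`), and the `t` entries after `r_c` leave
room for doing this `t` times.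

For the enumeration, the last `t` entries of such a permutation of `2 * c + t` numbers are the
largest ones in increasing order. An arrangement of the other `2 * c` numbers ends with their
maximum followed by any of the `2 * c - 1` remaining numbers, and deleting these two entries
leaves an arrangement of the same kind.
-/

namespace StackSort

/-! ### The stack-sorting map -/

/-- An entry larger than the whole input stays at the bottom of the stack and is output last. -/
theorem run_append_bottom (m : ℕ) (p st : List ℕ) (hp : ∀ x ∈ p, x < m) :
    run p (st ++ [m]) = run p st ++ [m] := by
  induction p, st using run.induct with
  | case1 => simp [run]
  | case2 b st ih => simpa [run] using ih
  | case3 a rest ih =>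
    have ha : a < m := hp a (by simp)
    have := ih (fun x hx => hp x (by simp [hx]))
    simp only [List.cons_append, List.nil_append] at this
    simp [run, ha, this]
  | case4 a rest b st hab ih =>
    have := ih (fun x hx => hp x (by simp [hx]))
    simp only [List.cons_append] at this
    simp [run, hab, this]
  | case5 a rest b st hab ih =>
    simp [run, hab, ih hp]

/-- An entry larger than everything before it empties the stack before it is pushed. -/
theorem run_append_cons (m : ℕ) (r p st : List ℕ) (hp : ∀ x ∈ p, x < m)
    (hst : ∀ x ∈ st, x < m) : run (p ++ m :: r) st = run p st ++ run r [m] := by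
  induction p, st using run.induct with
  | case1 => simp [run]
  | case2 b st ih =>
    have hb : b < m := hst b (by simp)
    have := ih hp (fun x hx => hst x (by simp [hx]))
    simp only [List.nil_append] at this
    simp [run, hb.le, this]
  | case3 a rest ih =>
    have ha : a < m := hp a (by simp)
    have := ih (fun x hx => hp x (by simp [hx])) (by simp [ha])
    simp [run, this]
  | case4 a rest b st hab ih =>
    have ha : a < m := hp a (by simp)
    have := ih (fun x hx => hp x (by simp [hx]))
      (fun x hx => by rcases List.mem_cons.1 hx with rfl | hx; exacts [ha, hst x hx])
    simp [run, hab, this]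
  | case5 a rest b st hab ih =>
    have := ih hp (fun x hx => hst x (by simp [hx]))
    simp only [List.cons_append] at this
    simp [run, hab, this]

theorem run_perm (p st : List ℕ) : (run p st).Perm (p ++ st) := by
  induction p, st using run.induct with
  | case1 => simp [run]
  | case2 b st ih => simpa [run] using ih
  | case3 a rest ih => simpa [run] using ih.trans (List.perm_append_singleton a rest)
  | case4 a rest b st hab ih =>
    simp only [run, hab, if_true]
    exact ih.trans List.perm_middle
  | case5 a rest b st hab ih =>
    simp only [run, hab, if_false]
    exact (ih.cons b).trans List.perm_middle.symm

theorem stackSort_perm (p : List ℕ) : (stackSort p).Perm p := by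
  simpa [stackSort] using run_perm p []

theorem length_stackSort (p : List ℕ) : (stackSort p).length = p.length :=
  (stackSort_perm p).length_eq

theorem nodup_stackSort {p : List ℕ} : (stackSort p).Nodup ↔ p.Nodup :=
  (stackSort_perm p).nodup_iff

theorem mem_stackSort {p : List ℕ} {x : ℕ} : x ∈ stackSort p ↔ x ∈ p :=
  (stackSort_perm p).mem_iff

@[simp] theorem stackSort_nil : stackSort [] = [] := by simp [stackSort, run]

@[simp] theorem stackSort_singleton (a : ℕ) : stackSort [a] = [a] := by simp [stackSort, run]

/-- The recursive description `s(L m R) = s(L) s(R) m` of the stack-sorting map, where `m` is the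
largest entry. -/
theorem stackSort_append_cons {l r : List ℕ} {m : ℕ} (hl : ∀ x ∈ l, x < m) (hr : ∀ x ∈ r, x < m) :
    stackSort (l ++ m :: r) = stackSort l ++ stackSort r ++ [m] := by
  have h := run_append_bottom m r [] hr
  simp only [List.nil_append] at h
  simp [stackSort, run_append_cons m r l [] hl (by simp), h]

theorem stackSort_concat {l : List ℕ} {m : ℕ} (hl : ∀ x ∈ l, x < m) :
    stackSort (l ++ [m]) = stackSort l ++ [m] := by
  simp [stackSort_append_cons hl (r := []) (by simp)]

theorem iterate_stackSort_perm (t : ℕ) (p : List ℕ) : (stackSort^[t] p).Perm p := by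
  induction t generalizing p with
  | zero => simp
  | succ t ih => exact (ih _).trans (stackSort_perm p)

theorem iterate_stackSort_concat (t : ℕ) {l : List ℕ} {m : ℕ} (hl : ∀ x ∈ l, x < m) :
    stackSort^[t] (l ++ [m]) = stackSort^[t] l ++ [m] := by
  induction t generalizing l with
  | zero => simp
  | succ t ih =>
    rw [Function.iterate_succ_apply, stackSort_concat hl,
      ih fun x hx => hl x (mem_stackSort.1 hx), Function.iterate_succ_apply]

theorem exists_eq_append_max {w : List ℕ} (hw : w ≠ []) (hd : w.Nodup) :
    ∃ l m r, w = l ++ m :: r ∧ (∀ x ∈ l, x < m) ∧ ∀ x ∈ r, x < m := by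
  obtain ⟨m, hm, hmax⟩ := w.toFinset.exists_max_image id (List.toFinset_nonempty_iff _ |>.2 hw)
  obtain ⟨l, r, rfl⟩ := List.append_of_mem (List.mem_toFinset.1 hm)
  have hd' := List.nodup_middle.1 hd
  simp only [List.nodup_cons, List.mem_append, not_or] at hd'
  refine ⟨l, m, r, rfl, fun x hx => lt_of_le_of_ne (hmax x (by simp [hx])) ?_,
    fun x hx => lt_of_le_of_ne (hmax x (by simp [hx])) ?_⟩
  · rintro rfl; exact hd'.1.1 hx
  · rintro rfl; exact hd'.1.2 hx

/-! ### Counting descents -/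

/-- The number of descents of a list, by recursion on the list. -/
def numDescents : List ℕ → ℕ
  | [] => 0
  | [_] => 0
  | a :: b :: l => (if b < a then 1 else 0) + numDescents (b :: l)

theorem des_eq_numDescents (p : List ℕ) : des p = numDescents p := by
  induction p with
  | nil => simp [des, descents, numDescents]
  | cons a l ih =>
    cases l with
    | nil => simp [des, descents, numDescents]
    | cons b l =>
      rw [numDescents, ← ih, des, des]
      have h : descents (a :: b :: l) =
          (if b < a then {1} else ∅) ∪ (descents (b :: l)).map (addRightEmbedding 1) := by
        ext i
        rcases i with _ | _ | i
        · split_ifs <;> simp [descents]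
        · split_ifs with h <;> simp [descents, entry, h]
        · split_ifs <;> simp [descents, entry]
      rw [h, Finset.card_union_of_disjoint, Finset.card_map]
      · split_ifs <;> simp
      · split_ifs <;> simp [descents]

theorem numDescents_append_cons_cons (l r : List ℕ) (a b : ℕ) :
    numDescents (l ++ a :: b :: r) =
      numDescents (l ++ [a]) + (if b < a then 1 else 0) + numDescents (b :: r) := by
  induction l with
  | nil => simp [numDescents]
  | cons c l ih =>
    cases l with
    | nil => simp [numDescents]; ring
    | cons d l =>
      simp only [List.cons_append, numDescents] at ih ⊢
      rw [ih]; ring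

theorem numDescents_append_le (p q : List ℕ) :
    numDescents (p ++ q) ≤ numDescents p + numDescents q + 1 := by
  rcases List.eq_nil_or_concat' p with rfl | ⟨l, a, rfl⟩
  · simp; omega
  cases q with
  | nil => simp; omega
  | cons b r =>
    have := numDescents_append_cons_cons l r a b
    simp only [List.append_assoc, List.singleton_append]
    split_ifs at this <;> omega

theorem numDescents_concat {l : List ℕ} {m : ℕ} (hl : ∀ x ∈ l, x < m) :
    numDescents (l ++ [m]) = numDescents l := by
  rcases List.eq_nil_or_concat' l with rfl | ⟨l, a, rfl⟩
  · simp [numDescents]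
  · have := numDescents_append_cons_cons l [] a m
    have ha : a < m := hl a (by simp)
    simp [this, ha.le, numDescents]

/-- A sorted permutation of length `n ≥ 1` has at most `(n - 1) / 2` descents. -/
theorem numDescents_stackSort_le {w : List ℕ} (hw : w ≠ []) (hd : w.Nodup) :
    2 * numDescents (stackSort w) + 1 ≤ w.length := by
  induction hn : w.length using Nat.strong_induction_on generalizing w with
  | _ n ih =>
  subst hn
  obtain ⟨l, m, r, rfl, hl, hr⟩ := exists_eq_append_max hw hd
  rw [stackSort_append_cons hl hr, numDescents_concat (by
    intro x hx
    rcases List.mem_append.1 hx with hx | hx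
    exacts [hl x (mem_stackSort.1 hx), hr x (mem_stackSort.1 hx)])]
  have hdl : l.Nodup := hd.of_append_left
  have hdr : r.Nodup := hd.of_append_right.of_cons
  have key := numDescents_append_le (stackSort l) (stackSort r)
  by_cases hl0 : l = [] <;> by_cases hr0 : r = []
  · simp [hl0, hr0, numDescents]
  · have := ih r.length (by simp; omega) hr0 hdr rfl
    simp [hl0]; omega
  · have := ih l.length (by simp) hl0 hdl rfl
    simp [hr0]; omega
  · have h1 := ih r.length (by simp; omega) hr0 hdr rfl
    have h2 := ih l.length (by simp) hl0 hdl rfl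
    simp; omega

theorem exists_stackSort_eq {w : List ℕ} (hw : w ≠ []) (hd : w.Nodup) :
    ∃ l r m, stackSort w = stackSort l ++ stackSort r ++ [m] ∧ (l ++ r).Nodup ∧
      (∀ x ∈ stackSort l ++ stackSort r, x < m) := by
  obtain ⟨l, m, r, rfl, hl, hr⟩ := exists_eq_append_max hw hd
  refine ⟨l, r, m, stackSort_append_cons hl hr, (List.nodup_middle.1 hd).of_cons, ?_⟩
  intro x hx
  rcases List.mem_append.1 hx with hx | hx
  exacts [hl x (mem_stackSort.1 hx), hr x (mem_stackSort.1 hx)]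

theorem nodup_stackSort_append {l r : List ℕ} :
    (stackSort l ++ stackSort r).Nodup ↔ (l ++ r).Nodup :=
  ((stackSort_perm l).append (stackSort_perm r)).nodup_iff

/-- A `2`-sorted permutation of length `n ≥ 2` has at most `(n - 2) / 2` descents. -/
theorem numDescents_stackSort_stackSort_le {w : List ℕ} (hw : 2 ≤ w.length) (hd : w.Nodup) :
    2 * numDescents (stackSort (stackSort w)) + 2 ≤ w.length := by
  have hw0 : w ≠ [] := by rintro rfl; simp at hw
  obtain ⟨l, r, m, h, hlr, hm⟩ := exists_stackSort_eq hw0 hd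
  have hlen := length_stackSort w
  rw [h, List.length_append, List.length_singleton] at hlen
  rw [h, stackSort_concat hm,
    numDescents_concat fun x hx => hm x (mem_stackSort.1 hx)]
  have := numDescents_stackSort_le (w := stackSort l ++ stackSort r)
    (by intro h0; rw [h0] at hlen; simp at hlen; omega) (nodup_stackSort_append.2 hlr)
  omega

/-! ### Positions of left-to-right maxima -/

/-- The left-to-right maxima of `v` stand exactly at the indices (counted from `0`) in `S`. -/
def LRMaxAt (S : ℕ → Prop) (v : List ℕ) : Prop :=
  ∀ i < v.length, (∀ j < i, v.getD j 0 < v.getD i 0) ↔ S i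

theorem LRMaxAt.congr {S T : ℕ → Prop} {v : List ℕ} (h : LRMaxAt S v)
    (hST : ∀ i < v.length, (S i ↔ T i)) : LRMaxAt T v :=
  fun i hi => (h i hi).trans (hST i hi)

theorem forall_getD_lt {v : List ℕ} {x : ℕ} :
    (∀ j < v.length, v.getD j 0 < x) ↔ ∀ y ∈ v, y < x := by
  constructor
  · intro h y hy
    obtain ⟨j, hj, rfl⟩ := List.mem_iff_getElem.1 hy
    simpa [hj] using h j hj
  · intro h j hj
    simpa [hj] using h _ (List.getElem_mem hj)

theorem lrMaxAt_concat {S : ℕ → Prop} {v : List ℕ} {x : ℕ} :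
    LRMaxAt S (v ++ [x]) ↔ LRMaxAt S v ∧ ((∀ y ∈ v, y < x) ↔ S v.length) := by
  have hlast : (∀ j < v.length, (v ++ [x]).getD j 0 < (v ++ [x]).getD v.length 0) ↔
      ∀ y ∈ v, y < x := by
    rw [← forall_getD_lt]
    refine forall₂_congr fun j hj => ?_
    rw [List.getD_append _ _ _ _ hj]; simp
  have hinit : ∀ i < v.length, ((∀ j < i, (v ++ [x]).getD j 0 < (v ++ [x]).getD i 0) ↔
      ∀ j < i, v.getD j 0 < v.getD i 0) := by
    intro i hi
    refine forall₂_congr fun j hj => ?_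
    rw [List.getD_append _ _ _ _ hi, List.getD_append _ _ _ _ (hj.trans hi)]
  constructor
  · intro h
    exact ⟨fun i hi => (hinit i hi).symm.trans (h i (by simp; omega)),
      hlast.symm.trans (h v.length (by simp))⟩
  · rintro ⟨h1, h2⟩ i hi
    rcases lt_or_eq_of_le (Nat.lt_succ_iff.1 (by simpa using hi)) with hi | rfl
    · exact (hinit i hi).trans (h1 i hi)
    · exact hlast.trans h2

theorem lrMaxAt_nil (S : ℕ → Prop) : LRMaxAt S [] := fun i hi => by simp at hi

/-- If `s(s(L) s(R))` has the largest number of descents that a sorted permutation of its length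
can have, then its left-to-right maxima stand exactly at the even indices. The largest
entry `m` cannot be the last one of `s(L) s(R)` unless it is the only one, since a final maximum
is fixed by `s` and takes part in no descent. So it ends `s(L)`, and `R` cannot have more than one
entry because `s(s(R))` is `2`-sorted and would have too few descents. Hence `s(s(L) s(R))` is
`s(s(L₁) s(L₂)) r m` where `L = L₁ m L₂` and `R = r`. -/
theorem lrMaxAt_even_of_numDescents_eq {l r : List ℕ} (hd : (l ++ r).Nodup)
    (h : 2 * numDescents (stackSort (stackSort l ++ stackSort r)) + 1 =
      (stackSort l ++ stackSort r).length) :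
    LRMaxAt Even (stackSort (stackSort l ++ stackSort r)) := by
  induction hn : l.length using Nat.strong_induction_on generalizing l r with
  | _ n ih =>
  subst hn
  have hconcat : ∀ (y : List ℕ) (m : ℕ), stackSort l ++ stackSort r = y ++ [m] →
      (∀ x ∈ y, x < m) → LRMaxAt Even (stackSort (stackSort l ++ stackSort r)) := by
    intro y m hy hlt
    have hyd : y.Nodup := (hy ▸ nodup_stackSort_append.2 hd).of_append_left
    rw [hy, stackSort_concat hlt,
      numDescents_concat fun x hx => hlt x (mem_stackSort.1 hx)] at h
    rw [hy, stackSort_concat hlt]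
    by_cases hy0 : y = []
    · subst hy0
      simpa using lrMaxAt_concat.2 ⟨lrMaxAt_nil Even, by simp⟩
    · have := numDescents_stackSort_le hy0 hyd
      simp at h; omega
  have hlr0 : l ++ r ≠ [] := by
    intro h0
    obtain ⟨rfl, rfl⟩ := List.append_eq_nil_iff.1 h0
    simp at h
  obtain ⟨m, hm, hmax⟩ := (l ++ r).toFinset.exists_max_image id
    (List.toFinset_nonempty_iff _ |>.2 hlr0)
  simp only [List.mem_toFinset, id] at hm hmax
  rcases List.mem_append.1 hm with hml | hmr
  · obtain ⟨l₁, l₂, rfl⟩ := List.append_of_mem hml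
    have hd' : (m :: (l₁ ++ (l₂ ++ r))).Nodup := by
      refine (List.nodup_middle (l₁ := l₁) (l₂ := l₂ ++ r)).1 ?_
      simpa using hd
    have hne : ∀ x ∈ l₁ ++ (l₂ ++ r), x < m := fun x hx => by
      refine lt_of_le_of_ne (hmax x ?_) ?_
      · simp at hx ⊢; tauto
      · rintro rfl; exact (List.nodup_cons.1 hd').1 hx
    have hs := stackSort_append_cons (l := l₁) (r := l₂) (m := m)
      (fun x hx => hne x (by simp [hx])) (fun x hx => hne x (by simp [hx]))
    by_cases hr0 : r = []
    · subst hr0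
      refine hconcat (stackSort l₁ ++ stackSort l₂) m (by simp [hs]) fun x hx => hne x ?_
      simpa [mem_stackSort] using hx
    have hd₁₂ : (l₁ ++ l₂).Nodup :=
      ((List.append_assoc l₁ l₂ r ▸ hd'.of_cons) : (l₁ ++ l₂ ++ r).Nodup).of_append_left
    have hdr : r.Nodup := hd.of_append_right
    have hw : stackSort (stackSort (l₁ ++ m :: l₂) ++ stackSort r) =
        stackSort (stackSort l₁ ++ stackSort l₂) ++ stackSort (stackSort r) ++ [m] := by
      rw [hs, List.append_assoc, List.singleton_append, stackSort_append_cons]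
      · exact fun x hx => hne x (by simp [mem_stackSort] at hx; simp; tauto)
      · exact fun x hx => hne x (by simp [mem_stackSort] at hx; simp; tauto)
    have hlt : ∀ x ∈ stackSort (stackSort l₁ ++ stackSort l₂) ++ stackSort (stackSort r),
        x < m := fun x hx => hne x (by simp [mem_stackSort] at hx; simp; tauto)
    have hb₁ : 1 ≤ r.length := List.length_pos_iff.2 hr0
    have hlen : (stackSort (l₁ ++ m :: l₂) ++ stackSort r).length =
        l₁.length + l₂.length + 1 + r.length := by
      simp [length_stackSort]; omega
    rw [hw, numDescents_concat hlt, hlen] at h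
    rw [hw]
    have hr₁ := numDescents_stackSort_le (w := stackSort r)
      (by intro h0; have := length_stackSort r; simp [h0] at this; omega) (nodup_stackSort.2 hdr)
    rw [length_stackSort] at hr₁
    by_cases h₁₂ : stackSort l₁ ++ stackSort l₂ = []
    · rw [h₁₂] at h
      simp only [stackSort_nil, List.nil_append] at h
      omega
    have hl₁ := numDescents_stackSort_le h₁₂ (nodup_stackSort_append.2 hd₁₂)
    have hlen₁₂ : (stackSort l₁ ++ stackSort l₂).length = l₁.length + l₂.length := by
      simp [length_stackSort]
    have happ := numDescents_append_le (stackSort (stackSort l₁ ++ stackSort l₂))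
      (stackSort (stackSort r))
    have hr1 : r.length = 1 := by
      by_contra hne1
      have := numDescents_stackSort_stackSort_le (w := r) (by omega) hdr
      omega
    obtain ⟨b, rfl⟩ := List.length_eq_one_iff.1 hr1
    simp only [stackSort_singleton, numDescents, List.length_singleton] at *
    have heq : 2 * numDescents (stackSort (stackSort l₁ ++ stackSort l₂)) + 1 =
      (stackSort l₁ ++ stackSort l₂).length := by omega
    have halt := ih l₁.length (by simp) hd₁₂ heq rfl
    have hodd : ¬ Even (stackSort (stackSort l₁ ++ stackSort l₂)).length := by
      rw [length_stackSort, ← heq]; simp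
    rw [lrMaxAt_concat, lrMaxAt_concat]
    refine ⟨⟨halt, iff_of_false ?_ hodd⟩, iff_of_true hlt ?_⟩
    · intro hall
      rw [numDescents_concat hall] at h
      omega
    · rw [List.length_append, List.length_singleton]
      exact Nat.even_add_one.2 hodd
  · obtain ⟨r₁, r₂, rfl⟩ := List.append_of_mem hmr
    have hd' : (m :: (l ++ (r₁ ++ r₂))).Nodup := by
      have := (List.nodup_middle (l₁ := l ++ r₁) (l₂ := r₂) (a := m)).1 (by simpa using hd)
      simpa using this
    have hne : ∀ x ∈ l ++ (r₁ ++ r₂), x < m := fun x hx => by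
      refine lt_of_le_of_ne (hmax x ?_) ?_
      · simp at hx ⊢; tauto
      · rintro rfl; exact (List.nodup_cons.1 hd').1 hx
    have hs := stackSort_append_cons (l := r₁) (r := r₂) (m := m)
      (fun x hx => hne x (by simp [hx])) (fun x hx => hne x (by simp [hx]))
    refine hconcat (stackSort l ++ (stackSort r₁ ++ stackSort r₂)) m (by simp [hs])
      fun x hx => hne x ?_
    simpa [mem_stackSort] using hx

/-- A `t`-sorted permutation of length `k + t` with `k / 2` descents has its left-to-right maxima
at the even indices and at all indices from `k` on. -/
theorem lrMaxAt_of_iterate_stackSort {t k : ℕ} (ht : 2 ≤ t) (hk : Even k) {w : List ℕ}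
    (hd : w.Nodup) (hlen : w.length = k + t) (hdes : 2 * numDescents (stackSort^[t] w) = k) :
    LRMaxAt (fun i => Even i ∨ k ≤ i) (stackSort^[t] w) := by
  induction t, ht using Nat.le_induction generalizing w with
  | base =>
    obtain ⟨l, r, m, h, hlr, hm⟩ := exists_stackSort_eq
      (by rintro rfl; simp at hlen) hd
    have hlen' := length_stackSort w
    rw [h, List.length_append, List.length_singleton] at hlen'
    have hm' := fun x hx => hm x (mem_stackSort.1 hx)
    have hw : stackSort^[2] w = stackSort (stackSort l ++ stackSort r) ++ [m] := by
      simp only [Function.iterate_succ, Function.iterate_zero, Function.comp, id]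
      rw [h, stackSort_concat hm]
    rw [hw, numDescents_concat hm'] at hdes
    have hl := length_stackSort (stackSort l ++ stackSort r)
    rw [hw, lrMaxAt_concat]
    refine ⟨(lrMaxAt_even_of_numDescents_eq hlr (by omega)).congr fun i hi => ?_,
      iff_of_true hm' (Or.inr (by omega))⟩
    refine ⟨Or.inl, fun hi' => hi'.elim id fun hki => ?_⟩
    obtain rfl : i = k := by omega
    exact hk
  | succ t ht ih =>
    obtain ⟨l, r, m, h, hlr, hm⟩ := exists_stackSort_eq
      (by rintro rfl; simp at hlen) hd
    have hlen' := length_stackSort w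
    rw [h, List.length_append, List.length_singleton] at hlen'
    have hm' : ∀ x ∈ stackSort^[t] (stackSort l ++ stackSort r), x < m :=
      fun x hx => hm x ((iterate_stackSort_perm _ _).mem_iff.1 hx)
    rw [Function.iterate_succ_apply, h, iterate_stackSort_concat t hm] at hdes ⊢
    rw [numDescents_concat hm'] at hdes
    have hl := (iterate_stackSort_perm t (stackSort l ++ stackSort r)).length_eq
    exact lrMaxAt_concat.2 ⟨ih (nodup_stackSort_append.2 hlr) (by omega) hdes,
      iff_of_true hm' (Or.inr (by omega))⟩

/-! ### Preimages of interleaved sequences -/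

/-- The interleaving `r₁ M₁ r₂ M₂ ⋯`, where a leftover of either list is appended at the end. -/
def weave : List ℕ → List ℕ → List ℕ
  | [], rs => rs
  | M, [] => M
  | a :: M, r :: rs => r :: a :: weave M rs

@[simp] theorem weave_nil_right (M : List ℕ) : weave M [] = M := by
  cases M <;> rfl

theorem weave_perm (M rs : List ℕ) : (weave M rs).Perm (M ++ rs) := by
  induction M generalizing rs with
  | nil => simp [weave]
  | cons a M ih =>
    cases rs with
    | nil => simp
    | cons r rs =>
      simp only [weave]
      refine (((ih rs).cons a).cons r).trans ?_
      exact (List.perm_middle (l₁ := a :: M)).symm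

/-- Reading `r₁ M₁ r₂ M₂ ⋯` with `a` on the stack, each `r` is popped immediately before the entry
of `a, M₁, M₂, …` on which it was pushed. -/
theorem run_weave (a : ℕ) (M rs : List ℕ) (hM : (a :: M).Pairwise (· < ·))
    (hrs : ∀ k < rs.length, rs.getD k 0 < (a :: M).getD k 0) :
    run (weave M rs) [a] = weave (a :: M) rs := by
  induction M generalizing a rs with
  | nil =>
    rcases rs with _ | ⟨r, _ | ⟨r', rs⟩⟩
    · simp [weave, run]
    · have : r < a := by simpa using hrs 0 (by simp)
      simp [weave, run, this]
    · have := hrs 1 (by simp)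
      simp at this
  | cons b M ih =>
    have hab : a < b := (List.pairwise_cons.1 hM).1 b (by simp)
    cases rs with
    | nil =>
      have := ih b [] hM.of_cons (by simp)
      simp only [weave_nil_right] at this
      simp [run, hab.le, this]
    | cons r rs =>
      have hr : r < a := by simpa using hrs 0 (by simp)
      have := ih b rs hM.of_cons fun k hk => by simpa using hrs (k + 1) (by simpa using hk)
      simp [weave, run, hr, hab.not_gt, (hr.trans hab).not_gt, this]

/-- The stack moves every entry `r` of the second list one step to the left, past one entry of
the increasing sequence. -/
theorem stackSort_append_weave (p : List ℕ) (a : ℕ) (M rs : List ℕ)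
    (hM : (p ++ a :: M).Pairwise (· < ·))
    (hrs : ∀ k < rs.length, rs.getD k 0 < (a :: M).getD k 0) :
    stackSort (p ++ a :: weave M rs) = p ++ weave (a :: M) rs := by
  obtain ⟨hp, haM, hpa⟩ := List.pairwise_append.1 hM
  have hsorted : stackSort p = p := by
    clear hpa hM
    induction p using List.reverseRecOn with
    | nil => simp
    | append_singleton p x ih =>
      obtain ⟨hp, -, hx⟩ := List.pairwise_append.1 hp
      rw [stackSort_concat (fun y hy => hx y hy x (by simp)), ih hp]
  rw [stackSort, run_append_cons a _ p [] (fun x hx => hpa x hx a (by simp)) (by simp),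
    run_weave a M rs haM hrs]
  rw [stackSort] at hsorted
  rw [hsorted]

/-- Starting with all the entries `r` shifted `i` steps to the right, `i` applications of `s`
return to `M₁ r₁ M₂ r₂ ⋯`. -/
theorem iterate_stackSort_weave (M rs : List ℕ) (hM : M.Pairwise (· < ·))
    (hrs : ∀ k < rs.length, rs.getD k 0 < M.getD k 0) (t : ℕ) (ht : rs.length + t ≤ M.length)
    (i : ℕ) (hit : i ≤ t) (htM : t < M.length) :
    stackSort^[i] (M.take (i + 1) ++ weave (M.drop (i + 1)) rs) =
      M.take 1 ++ weave (M.drop 1) rs := by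
  induction i with
  | zero => simp
  | succ i ih =>
    have hi : i + 1 < M.length := by omega
    rw [Function.iterate_succ_apply, ← ih (by omega)]
    congr 1
    have h := stackSort_append_weave (M.take (i + 1)) M[i + 1] (M.drop (i + 2)) rs
      (by rwa [List.getElem_cons_drop, List.take_append_drop]) (by
        intro k hk
        rw [List.getElem_cons_drop]
        refine (hrs k hk).trans_le ?_
        have h1 : k < M.length := by omega
        have h2 : i + 1 + k < M.length := by omega
        simp only [List.getD_eq_getElem?_getD, List.getElem?_drop, List.getElem?_eq_getElem h1,
          List.getElem?_eq_getElem h2, Option.getD_some]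
        exact (List.pairwise_iff_getElem.1 hM k (i + 1 + k) h1 h2 (by omega)).le)
    rw [List.getElem_cons_drop] at h
    rw [← h, List.take_succ_eq_append_getElem hi, List.append_assoc, List.singleton_append]

/-- A list whose left-to-right maxima stand at the even indices and at all indices from `2 * c`
on is `M₁ r₁ M₂ r₂ ⋯ M_c r_c M_{c+1} ⋯` with `M` increasing and `r_k < M_k`. -/
theorem exists_weave_of_lrMaxAt (c : ℕ) (a : ℕ) (v : List ℕ) (hd : (a :: v).Nodup)
    (hlen : 2 * c < (a :: v).length) (h : LRMaxAt (fun i => Even i ∨ 2 * c ≤ i) (a :: v)) :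
    ∃ M rs, v = weave M rs ∧ rs.length = c ∧ M.length + c = v.length ∧
      (a :: M).Pairwise (· < ·) ∧ ∀ k < rs.length, rs.getD k 0 < (a :: M).getD k 0 := by
  induction c generalizing a v with
  | zero =>
    refine ⟨v, [], by simp, rfl, rfl, List.pairwise_iff_getElem.2 fun i j hi hj hij => ?_,
      by simp⟩
    have := (h j hj).2 (Or.inr (by omega)) i hij
    simpa [List.getD_eq_getElem?_getD, List.getElem?_eq_getElem hi,
      List.getElem?_eq_getElem hj] using this
  | succ c ih =>
    obtain ⟨r, b, v, rfl⟩ : ∃ r b v', v = r :: b :: v' := by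
      rcases v with _ | ⟨r, _ | ⟨b, v⟩⟩
      · simp at hlen
      · simp at hlen; omega
      · exact ⟨r, b, v, rfl⟩
    have hra : r < a := by
      have h1 := (h 1 (by simp)).not.2 (by simp; omega)
      have hne : a ≠ r := by rintro rfl; simp at hd
      simp at h1
      omega
    have hab : a < b := by
      simpa using (h 2 (by simp)).2 (Or.inl (by simp)) 0 (by omega)
    have htail : LRMaxAt (fun i => Even i ∨ 2 * c ≤ i) (b :: v) := by
      intro i hi
      have h2 := h (i + 2) (by simpa using hi)
      have hS : (Even (i + 2) ∨ 2 * (c + 1) ≤ i + 2) ↔ (Even i ∨ 2 * c ≤ i) := by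
        simp only [Nat.even_iff]; omega
      refine Iff.trans ?_ (h2.trans hS)
      simp only [List.getD_cons_succ]
      constructor
      · intro hj j hji
        have hbi : b ≤ (b :: v).getD i 0 := by
          rcases i with _ | i
          · simp
          · simpa using (hj 0 (by omega)).le
        rcases j with _ | _ | j
        · simp only [List.getD_cons_zero]; omega
        · simp only [List.getD_cons_succ, List.getD_cons_zero]; omega
        · simpa using hj j (by omega)
      · intro hj j hji
        simpa using hj (j + 2) (by omega)
    obtain ⟨M, rs, rfl, hrs, hM, hpw, hlt⟩ := ih b v hd.of_cons.of_cons
      (by simp at hlen ⊢; omega) htail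
    refine ⟨b :: M, r :: rs, rfl, by simp [hrs], by simp; omega, ?_, ?_⟩
    · refine List.pairwise_cons.2 ⟨fun x hx => ?_, hpw⟩
      rcases List.mem_cons.1 hx with rfl | hx
      exacts [hab, hab.trans ((List.pairwise_cons.1 hpw).1 x hx)]
    · rintro (_ | k) hk
      · simpa using hra
      · simpa using hlt k (by simpa using hk)

theorem isTSorted_of_lrMaxAt {c t : ℕ} (ht : 1 ≤ t) {p : List ℕ} (hp : IsPermutation p)
    (hlen : p.length = 2 * c + t) (h : LRMaxAt (fun i => Even i ∨ 2 * c ≤ i) p) :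
    IsTSorted t p := by
  obtain ⟨a, v, rfl⟩ : ∃ a v, p = a :: v := by
    cases p with
    | nil => simp at hlen; omega
    | cons a v => exact ⟨a, v, rfl⟩
  obtain ⟨M, rs, rfl, hrs, hM, hpw, hlt⟩ := exists_weave_of_lrMaxAt c a v hp.1 (by omega) h
  simp only [List.length_cons] at hlen
  -- For `c = 0` there are only `t` left-to-right maxima, one too few for the prefix of length
  -- `t + 1` in `iterate_stackSort_weave`; but then the list is increasing, hence a fixed point.
  rcases Nat.eq_zero_or_pos c with rfl | hc
  · obtain rfl := List.length_eq_zero_iff.1 hrs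
    refine ⟨_, hp, Function.iterate_fixed ?_ t⟩
    simpa [weave] using stackSort_append_weave [] a M [] (by simpa using hpw) (by simp)
  have key := iterate_stackSort_weave (a :: M) rs hpw hlt t (by simp; omega) t le_rfl
    (by simp; omega)
  refine ⟨_, ?_, by simpa using key⟩
  have hperm := (iterate_stackSort_perm t
    ((a :: M).take (t + 1) ++ weave ((a :: M).drop (t + 1)) rs)).symm
  rw [key] at hperm
  simp only [List.take_succ_cons, List.take_zero, List.drop_succ_cons, List.drop_zero,
    List.singleton_append] at hperm
  exact ⟨hperm.nodup_iff.2 hp.1, fun x hx => hp.2 x (hperm.mem_iff.1 hx)⟩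

/-- If the left-to-right maxima stand at the even indices and at all indices from `2 * c` on,
there are exactly `c` descents. -/
theorem numDescents_of_lrMaxAt (c : ℕ) (a : ℕ) (v : List ℕ) (hd : (a :: v).Nodup)
    (hlen : 2 * c < (a :: v).length) (h : LRMaxAt (fun i => Even i ∨ 2 * c ≤ i) (a :: v)) :
    numDescents (a :: v) = c := by
  obtain ⟨M, rs, rfl, rfl, -, hpw, hlt⟩ := exists_weave_of_lrMaxAt c a v hd hlen h
  simp only [List.length_cons, (weave_perm M rs).length_eq, List.length_append] at hlen
  clear h hd
  induction rs generalizing a M with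
  | nil =>
    simp only [weave_nil_right, List.length_nil]
    induction M generalizing a with
    | nil => rfl
    | cons b M ih =>
      have hab : a < b := (List.pairwise_cons.1 hpw).1 b (by simp)
      rw [numDescents, ih b hpw.of_cons (by simp) (by simp), if_neg (by omega)]
  | cons r rs ih =>
    cases M with
    | nil => simp at hlen
    | cons b M =>
      have hab : a < b := (List.pairwise_cons.1 hpw).1 b (by simp)
      have hr : r < a := by simpa using hlt 0 (by simp)
      have := ih b M hpw.of_cons (fun k hk => by simpa using hlt (k + 1) (by simpa using hk))
        (by simp at hlen; omega)
      rw [weave, numDescents, numDescents, this, if_pos hr, if_neg (by omega)]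
      simp; omega

/-! ### Counting -/

theorem lrMaxAt_concat_concat {v : List ℕ} (hv : Even v.length) {a r : ℕ} (har : r ≠ a) :
    LRMaxAt Even (v ++ [a] ++ [r]) ↔ LRMaxAt Even v ∧ (∀ y ∈ v, y < a) ∧ r < a := by
  have hv1 : ¬ Even (v ++ [a]).length := by simpa [Nat.even_add_one] using hv
  rw [lrMaxAt_concat, lrMaxAt_concat, and_assoc]
  refine and_congr_right fun _ => ?_
  simp only [hv, hv1, iff_true, iff_false]
  refine and_congr_right fun ha => ⟨fun h => ?_, fun h h' => ?_⟩
  · by_contra hra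
    refine h fun y hy => ?_
    rcases List.mem_append.1 hy with hy | hy
    · have := ha y hy; omega
    · obtain rfl := List.mem_singleton.1 hy; omega
  · exact absurd (h' a (by simp)) (by omega)

/-- The arrangements of a set of `2 * c` numbers whose left-to-right maxima stand exactly at the
even indices are counted by `(2 * c - 1)‼`: such an arrangement ends with the largest number
followed by an arbitrary other one, and the rest is an arrangement of the same kind. -/
theorem exists_finset_lrMaxAt_even (c : ℕ) (V : Finset ℕ) (hV : V.card = 2 * c) :
    ∃ F : Finset (List ℕ), (∀ v, v ∈ F ↔ v.Nodup ∧ v.toFinset = V ∧ LRMaxAt Even v) ∧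
      F.card = (2 * c - 1)‼ := by
  induction c generalizing V with
  | zero =>
    obtain rfl := Finset.card_eq_zero.1 hV
    refine ⟨{[]}, fun v => ?_, by simp⟩
    rw [Finset.mem_singleton]
    constructor
    · rintro rfl; simp [lrMaxAt_nil]
    · rintro ⟨-, h, -⟩; simpa using h
  | succ c ih =>
    have hne : V.Nonempty := Finset.card_pos.1 (by omega)
    set m := V.max' hne with hm
    have hmV : m ∈ V := V.max'_mem hne
    have hW : ∀ r ∈ V.erase m, ((V.erase m).erase r).card = 2 * c := fun r hr => by
      rw [Finset.card_erase_of_mem hr, Finset.card_erase_of_mem hmV]; omega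
    choose! F hF hFc using fun r hr => ih ((V.erase m).erase r) (hW r hr)
    refine ⟨(V.erase m).biUnion fun r => (F r).image (· ++ [m] ++ [r]), fun v => ?_, ?_⟩
    · simp only [Finset.mem_biUnion, Finset.mem_image]
      constructor
      · rintro ⟨r, hr, w, hw, rfl⟩
        obtain ⟨hwd, hwV, hwA⟩ := (hF r hr w).1 hw
        have hrm : r ≠ m := Finset.ne_of_mem_erase hr
        have hmem : ∀ x, x ∈ w ↔ x ≠ r ∧ x ≠ m ∧ x ∈ V := fun x => by
          rw [← List.mem_toFinset, hwV]; simp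
        have hlen : Even w.length := by
          rw [← List.toFinset_card_of_nodup hwd, hwV, hW r hr]; simp
        refine ⟨?_, ?_, (lrMaxAt_concat_concat hlen hrm).2 ⟨hwA, fun y hy => ?_, ?_⟩⟩
        · simp only [List.append_assoc, List.nodup_append, List.mem_append, List.mem_singleton]
          refine ⟨hwd, ⟨by simp, by simp, ?_⟩, ?_⟩
          · rintro x rfl y rfl; exact hrm.symm
          · rintro x hx y (rfl | rfl)
            exacts [((hmem x).1 hx).2.1, ((hmem x).1 hx).1]
        · ext x
          simp only [List.mem_toFinset, List.mem_append, List.mem_singleton, hmem]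
          constructor
          · rintro ((h | rfl) | rfl)
            exacts [h.2.2, hmV, Finset.mem_of_mem_erase hr]
          · intro h; tauto
        · exact lt_of_le_of_ne (V.le_max' y ((hmem y).1 hy).2.2) ((hmem y).1 hy).2.1
        · exact lt_of_le_of_ne (V.le_max' r (Finset.mem_of_mem_erase hr)) hrm
      · rintro ⟨hvd, hvV, hvA⟩
        have hlen : v.length = 2 * (c + 1) := by
          rw [← List.toFinset_card_of_nodup hvd, hvV, hV]
        rcases List.eq_nil_or_concat' v with rfl | ⟨v, r, rfl⟩
        · simp at hlen
        rcases List.eq_nil_or_concat' v with rfl | ⟨v, a, rfl⟩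
        · simp at hlen; omega
        have hd' := List.nodup_append.1 hvd
        have hd'' := List.nodup_append.1 hd'.1
        have hra : r ≠ a := fun h => hd'.2.2 a (by simp) r (by simp) h.symm
        obtain ⟨hvA, hva, hra'⟩ := (lrMaxAt_concat_concat
          (by simp at hlen; exact ⟨c, by omega⟩) hra).1 hvA
        have hmemV : ∀ x, x ∈ V ↔ (x ∈ v ∨ x = a) ∨ x = r := fun x => by
          rw [← hvV]; simp; tauto
        have ham : a = m := by
          refine le_antisymm (V.le_max' a ((hmemV a).2 (by simp))) (V.max'_le hne _ fun y hy => ?_)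
          rcases (hmemV y).1 hy with (h | rfl) | rfl
          exacts [(hva y h).le, le_rfl, hra'.le]
        have hrV : r ∈ V.erase m := Finset.mem_erase.2 ⟨ham ▸ hra, (hmemV r).2 (by simp)⟩
        refine ⟨r, hrV, v, (hF r hrV v).2 ⟨hd''.1, ?_, hvA⟩, by rw [ham]⟩
        ext x
        simp only [List.mem_toFinset, Finset.mem_erase, hmemV, ← ham]
        constructor
        · intro hx
          exact ⟨hd'.2.2 x (by simp [hx]) r (by simp), hd''.2.2 x hx a (by simp),
            Or.inl (Or.inl hx)⟩
        · tauto
    · rw [Finset.card_biUnion]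
      · rw [Finset.sum_congr rfl fun r hr => by
          rw [Finset.card_image_of_injective _ (fun x y hxy => by simpa using hxy), hFc r hr]]
        rw [Finset.sum_const, Finset.card_erase_of_mem hmV, hV, smul_eq_mul]
        rcases c with _ | c
        · simp
        · exact (Nat.doubleFactorial_add_two (2 * c + 1)).symm
      · intro r _ r' _ hrr
        rw [Function.onFun, Finset.disjoint_left]
        simp only [Finset.mem_image]
        rintro _ ⟨w, -, rfl⟩ ⟨w', -, h⟩
        -- The two sets of arrangements differ in the last entry.
        have := List.append_inj_right' h rfl
        simp at this
        exact hrr this.symm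

theorem length_of_mem_Sn {n : ℕ} {p : List ℕ} (hp : p ∈ Sn n) : p.length = n := by
  rw [← List.toFinset_card_of_nodup hp.1, hp.2]; simp

theorem ncard_lrMaxAt (c t : ℕ) :
    {p : List ℕ | p ∈ Sn (2 * c + t) ∧ LRMaxAt (fun i => Even i ∨ 2 * c ≤ i) p}.ncard =
      (2 * c - 1)‼ := by
  induction t with
  | zero =>
    obtain ⟨F, hF, hFc⟩ := exists_finset_lrMaxAt_even c (Finset.Icc 1 (2 * c)) (by simp)
    rw [← hFc, ← Set.ncard_coe_finset]
    congr 1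
    ext p
    simp only [Set.mem_ofPred_eq, Finset.mem_coe, hF, ← and_assoc]
    refine and_congr_right fun hp => ?_
    have hlen : p.length = 2 * c := length_of_mem_Sn hp
    exact ⟨fun h => h.congr fun i hi => by simp; omega,
      fun h => h.congr fun i hi => by simp; omega⟩
  | succ t ih =>
    rw [← ih, ← Set.ncard_image_of_injective
      {p : List ℕ | p ∈ Sn (2 * c + t) ∧ LRMaxAt (fun i => Even i ∨ 2 * c ≤ i) p}
      (f := fun p : List ℕ => p ++ [2 * c + t + 1]) (fun x y hxy => by simpa using hxy)]
    congr 1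
    ext p
    simp only [Set.mem_ofPred_eq, Set.mem_image]
    constructor
    · rintro ⟨hp, h⟩
      have hlen := length_of_mem_Sn hp
      rcases List.eq_nil_or_concat' p with rfl | ⟨v, a, rfl⟩
      · simp at hlen
      simp only [List.length_append, List.length_singleton] at hlen
      obtain ⟨h1, h2⟩ := lrMaxAt_concat.1 h
      have hmax := h2.2 (Or.inr (by omega))
      have hmem : ∀ x, (x ∈ v ∨ x = a) ↔ 1 ≤ x ∧ x ≤ 2 * c + (t + 1) := fun x => by
        rw [← Finset.mem_Icc, ← hp.2]; simp [or_comm]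
      have ha : a = 2 * c + t + 1 := by
        have hle := (hmem a).1 (Or.inr rfl)
        rcases (hmem (2 * c + (t + 1))).2 (by omega) with h | h
        · have := hmax _ h; omega
        · omega
      refine ⟨v, ⟨⟨hp.1.of_append_left, ?_⟩, h1⟩, by rw [ha]⟩
      ext x
      rw [List.mem_toFinset, Finset.mem_Icc]
      constructor
      · intro hx
        have := (hmem x).1 (Or.inl hx)
        have := hmax x hx
        omega
      · intro hx
        rcases (hmem x).2 (by omega) with h | h
        · exact h
        · omega
    · rintro ⟨v, ⟨hv, h⟩, rfl⟩
      have hlen := length_of_mem_Sn hv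
      have hmem : ∀ x, x ∈ v ↔ 1 ≤ x ∧ x ≤ 2 * c + t := fun x => by
        rw [← Finset.mem_Icc, ← hv.2]; simp
      refine ⟨⟨?_, ?_⟩, lrMaxAt_concat.2 ⟨h, iff_of_true (fun y hy => ?_) (Or.inr (by omega))⟩⟩
      · refine List.nodup_append.2 ⟨hv.1, by simp, fun x hx y hy => ?_⟩
        have := (hmem x).1 hx
        simp at hy
        omega
      · ext x
        simp only [List.mem_toFinset, List.mem_append, List.mem_singleton, hmem, Finset.mem_Icc]
        omega
      · have := (hmem y).1 hy
        omega

/-! ### The characterization -/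

theorem entry_injOn {p : List ℕ} (hp : p.Nodup) :
    Set.InjOn (entry p) (Finset.Icc 1 p.length : Finset ℕ) := by
  intro i hi j hj hij
  simp only [Finset.coe_Icc, Set.mem_Icc] at hi hj
  have hi' : i - 1 < p.length := by omega
  have hj' : j - 1 < p.length := by omega
  simp only [entry, List.getD_eq_getElem?_getD, List.getElem?_eq_getElem hi',
    List.getElem?_eq_getElem hj', Option.getD_some] at hij
  have := (hp.getElem_inj_iff).1 hij
  omega

theorem leftToRightMaxima_eq_iff {n t c : ℕ} (hn : n = 2 * c + t) {p : List ℕ} (hp : p ∈ Sn n) :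
    leftToRightMaxima p = (extremalPositions n t).image (entry p) ↔
      LRMaxAt (fun i => Even i ∨ 2 * c ≤ i) p := by
  have hlen := length_of_mem_Sn hp
  rw [leftToRightMaxima, extremalPositions, ← Finset.coe_inj, Finset.coe_image, Finset.coe_image,
    (entry_injOn hp.1).image_eq_image_iff
      (Finset.coe_subset.2 (Finset.filter_subset _ _))
      (Finset.coe_subset.2 (hlen ▸ Finset.filter_subset _ _)), Finset.coe_inj, hlen]
  rw [Finset.filter_inj']
  have hpos : ∀ i, ((Odd (i + 1) ∧ i + 1 ≤ n - t + 1) ∨ n - t + 2 ≤ i + 1) ↔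
      (Even i ∨ 2 * c ≤ i) := fun i => by
    rw [Nat.odd_add_one, Nat.not_odd_iff_even]
    simp only [Nat.even_iff]
    omega
  have hmax : ∀ i, (∀ j < i + 1, 1 ≤ j → entry p j < entry p (i + 1)) ↔
      ∀ j < i, p.getD j 0 < p.getD i 0 := fun i => by
    constructor
    · intro h j hj
      simpa [entry] using h (j + 1) (by omega) (by omega)
    · intro h j hj hj1
      simpa [entry] using h (j - 1) (by omega)
  constructor
  · intro h i hi
    refine (hmax i).symm.trans (Iff.trans ?_ (hpos i))
    exact h (Finset.mem_Icc.2 (by omega))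
  · intro h i hi
    obtain ⟨hi1, hi2⟩ := Finset.mem_Icc.1 hi
    obtain ⟨i, rfl⟩ : ∃ j, i = j + 1 := ⟨i - 1, by omega⟩
    rw [hpos, hmax]
    exact h i (by omega)

theorem isTSorted_and_des_eq_iff {t c : ℕ} (ht : 2 ≤ t) {p : List ℕ} (hp : p ∈ Sn (2 * c + t)) :
    (IsTSorted t p ∧ des p = c) ↔ LRMaxAt (fun i => Even i ∨ 2 * c ≤ i) p := by
  have hlen := length_of_mem_Sn hp
  rw [des_eq_numDescents]
  constructor
  · rintro ⟨⟨μ, hμ, rfl⟩, hdes⟩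
    refine lrMaxAt_of_iterate_stackSort ht (by simp) hμ.1 ?_ (by rw [hdes])
    rw [← (iterate_stackSort_perm t μ).length_eq, hlen]
  · intro h
    refine ⟨isTSorted_of_lrMaxAt (by omega) ⟨hp.1, fun x hx => ?_⟩ hlen h, ?_⟩
    · rw [← List.mem_toFinset, hp.2, Finset.mem_Icc] at hx
      exact hx.1
    · cases p with
      | nil => simp at hlen; omega
      | cons a v => exact numDescents_of_lrMaxAt c a v hp.1 (by omega) h

end StackSort

theorem theorem3 (n t : ℕ) (ht : 2 ≤ t) (htn : t ≤ n) (hpar : n ≡ t [MOD 2]) :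
    (∀ π ∈ StackSort.Sn n,
      (StackSort.IsTSorted t π ∧ StackSort.des π = (n - t) / 2) ↔
        StackSort.leftToRightMaxima π =
          (StackSort.extremalPositions n t).image (StackSort.entry π)) ∧
    {π : List ℕ | π ∈ StackSort.Sn n ∧ StackSort.IsTSorted t π ∧
      StackSort.des π = (n - t) / 2}.ncard = (n - t - 1)‼ := by
  obtain ⟨c, rfl⟩ : ∃ c, n = 2 * c + t := by
    have := (Nat.modEq_iff_dvd' htn).1 hpar.symm
    obtain ⟨c, hc⟩ := this
    exact ⟨c, by omega⟩
  have hc : (2 * c + t - t) / 2 = c := by omega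
  rw [hc]
  refine ⟨fun π hπ => ?_, ?_⟩
  · rw [StackSort.leftToRightMaxima_eq_iff rfl hπ, StackSort.isTSorted_and_des_eq_iff ht hπ]
  · rw [Nat.add_sub_cancel, ← StackSort.ncard_lrMaxAt c t]
    congr 1
    ext π
    exact and_congr_right fun hπ => StackSort.isTSorted_and_des_eq_iff ht hπ
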